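/- Theorem (Gaussian Compression Error Bound). For every damping $\lambda>0$ there is a constant $K=K(\lambda)>0$, depending only on $\lambda$, with the following property. Let $r\le d$ and let $P\in\mathbb{R}^{r\times d}$ be a random Gaussian projection, i.e. its entries are independent standard normal random variables. For $0<n<d$, let $H\in\mathbb{R}^{d\times d}$ be a curvature matrix of a training set of size $n$, that is, either the Gauss–Newton matrix $H=\frac1n\sum_{i=1}^n g_i g_i^{T}$ of training gradients $g_1,\dots,g_n\in\mathbb{R}^d$, or the empirical Hessian $H=\frac1n\sum_{i=1}^n\nabla^2\ell_i(\theta)$ of twice differentiable convex losses $\ell_1,\dots,\ell_n:\mathbb{R}^d\to\mathbb{R}$ at a point $\theta\in\mathbb{R}^d$. Put $$\Delta H=(\lambda I_d+H)^{-1}-P^{T}(\lambda I_r+PHP^{T})^{-1}P .$$ Then, writing $\|\cdot\|_2$ for the spectral norm and $\sigma_{\max}$ for the largest singular value, if $\lambda I_d+P^{T}PH$ is invertible, both inverses in $\Delta H$ exist and $$\|\Delta H\|_2\le K\bigl(d+d^2\sigma_{\max}(H)\bigr),\qquad (*)$$ in the following two senses: 1. For all $r\le d$, the probability that $(*)$,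 together with the existence of the inverses, fails for some $n$ and some such $H$ (with $0<n<d$ and $\lambda I_d+P^TPH$ invertible) is at most $e^{-d}$. 2. For every choice of $r_d\le d$ and all random Gaussian projections $P_d\in\mathbb{R}^{r_d\times d}$, $d=0,1,2,\dots$, on a common probability space (with no assumption on their joint law), almost surely, for all sufficiently large $d$, $(*)$ and the existence of the inverses hold for $P=P_d$ simultaneously for all such $n$ and $H$ with $\lambda I_d+P_d^TP_dH$ invertible. -/

import Mathlib

open MeasureTheory ProbabilityTheory Filter
open scoped Matrix Matrix.Norms.L2Operator ENNReal

/-- The largest singular value of a real matrix (singular values are listed in decreasing order). -/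
noncomputable def sigmaMax {m n : ℕ} (A : Matrix (Fin m) (Fin n) ℝ) : ℝ :=
  (Matrix.toEuclideanLin A).singularValues 0

/-- The Gauss-Newton (empirical Fisher) matrix `(1/n) ∑ i, g i (g i)ᵀ` of the per-sample
gradients `g i`. -/
noncomputable def gaussNewton {n d : ℕ} (g : Fin n → EuclideanSpace ℝ (Fin d)) :
    Matrix (Fin d) (Fin d) ℝ :=
  (1 / (n : ℝ)) • ∑ i, Matrix.vecMulVec (g i) (g i)

/-- The empirical Hessian `(1/n) ∑ i, ∇² (ℓ i) (θ)` of the per-sample losses `ℓ i` at `θ`. -/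
noncomputable def empiricalHessian {n d : ℕ} (ℓ : Fin n → EuclideanSpace ℝ (Fin d) → ℝ)
    (θ : EuclideanSpace ℝ (Fin d)) : Matrix (Fin d) (Fin d) ℝ :=
  (1 / (n : ℝ)) • ∑ i, Matrix.of fun a b =>
    fderiv ℝ (fderiv ℝ (ℓ i)) θ (EuclideanSpace.single a 1) (EuclideanSpace.single b 1)

/-- `H` is a curvature matrix of a training set of size `n` for a model with `d` parameters:
either the Gauss-Newton matrix of the `n` training gradients, or the empirical Hessian of `n`
twice differentiable convex training losses. -/
def IsCurvatureMatrix (n : ℕ) {d : ℕ} (H : Matrix (Fin d) (Fin d) ℝ) : Prop :=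
  (∃ g : Fin n → EuclideanSpace ℝ (Fin d), H = gaussNewton g) ∨
  (∃ (ℓ : Fin n → EuclideanSpace ℝ (Fin d) → ℝ) (θ : EuclideanSpace ℝ (Fin d)),
    (∀ i, Differentiable ℝ (ℓ i)) ∧ (∀ i, Differentiable ℝ (fderiv ℝ (ℓ i))) ∧
    (∀ i, ConvexOn ℝ Set.univ (ℓ i)) ∧ H = empiricalHessian ℓ θ)

/-- A random Gaussian projection: the entries are independent standard normal variables. -/
def IsGaussianProjection {Ω : Type*} [MeasurableSpace Ω] (μ : Measure Ω) {r d : ℕ}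
    (P : Ω → Matrix (Fin r) (Fin d) ℝ) : Prop :=
  (∀ i j, HasLaw (fun ω => P ω i j) (gaussianReal 0 1) μ) ∧
  iIndepFun (fun (ij : Fin r × Fin d) ω => P ω ij.1 ij.2) μ

/-- The compression error `ΔH = (λ I_d + H)⁻¹ - Pᵀ (λ I_r + P H Pᵀ)⁻¹ P`. -/
noncomputable def compressionError {r d : ℕ} (lam : ℝ) (P : Matrix (Fin r) (Fin d) ℝ)
    (H : Matrix (Fin d) (Fin d) ℝ) : Matrix (Fin d) (Fin d) ℝ :=
  (lam • (1 : Matrix (Fin d) (Fin d) ℝ) + H)⁻¹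
    - Pᵀ * (lam • (1 : Matrix (Fin r) (Fin r) ℝ) + P * H * Pᵀ)⁻¹ * P

/-- For the realized projection `P`, simultaneously for all training set sizes `0 < n < d` and all
curvature matrices `H` of such training sets with `λ I_d + Pᵀ P H` invertible: both inverses in
`ΔH` exist, and the spectral norm of `ΔH` is at most `K (d + d² σ_max(H))`. -/
def CompressionErrorBound {r d : ℕ} (lam K : ℝ) (P : Matrix (Fin r) (Fin d) ℝ) : Prop :=
  ∀ n : ℕ, 0 < n → n < d → ∀ H : Matrix (Fin d) (Fin d) ℝ, IsCurvatureMatrix n H →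
    IsUnit (lam • (1 : Matrix (Fin d) (Fin d) ℝ) + Pᵀ * P * H) →
    IsUnit (lam • (1 : Matrix (Fin d) (Fin d) ℝ) + H) ∧
    IsUnit (lam • (1 : Matrix (Fin r) (Fin r) ℝ) + P * H * Pᵀ) ∧
    ‖compressionError lam P H‖ ≤ K * ((d : ℝ) + (d : ℝ) ^ 2 * sigmaMax H)

/-! Both kinds of curvature matrix are positive semidefinite, so `λI + H` and `λI + P H Pᵀ` are
bounded below by `λ`. They are therefore invertible with inverses of norm at most `1/λ`, whence
`‖ΔH‖ ≤ (1 + ‖P‖²)/λ`. It remains to show that `‖P‖² ≤ 120² d` outside an event of probability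
`e^{-d}`.

A volume argument replaces an ε-net. Average `exp(√d ⟨v, P u⟩)` over `u`, `v` in balls of radius 2:
its expectation is at most `e^{8d}`. If `‖P‖ ≥ 120√d`, the integrand is at least `e^{15d}` on a
product of balls of radius `1/8`, a fraction `16^{-(d+r)} ≥ e^{-6d}` of the domain. Markov's
inequality leaves `e^{(8+6-15)d} = e^{-d}`, and Borel–Cantelli gives the almost sure form. -/

/-- The second derivative of a twice differentiable convex function is positive semidefinite. -/
lemma ConvexOn.fderiv_fderiv_apply_self_nonneg {E : Type*} [NormedAddCommGroup E]
    [NormedSpace ℝ E] {f : E → ℝ} (hc : ConvexOn ℝ Set.univ f) (hf : Differentiable ℝ f)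
    (hf' : Differentiable ℝ (fderiv ℝ f)) (x w : E) : 0 ≤ fderiv ℝ (fderiv ℝ f) x w w := by
  have hline : ∀ t : ℝ, HasDerivAt (fun t : ℝ => x + t • w) w t := fun t => by
    simpa using ((hasDerivAt_id t).smul_const w).const_add x
  have h1 : ∀ t : ℝ, HasDerivAt (fun t : ℝ => f (x + t • w)) (fderiv ℝ f (x + t • w) w) t :=
    fun t => (hf (x + t • w)).hasFDerivAt.comp_hasDerivAt t (hline t)
  have h2 : HasDerivAt (fun t : ℝ => fderiv ℝ f (x + t • w) w)
      (fderiv ℝ (fderiv ℝ f) x w w) 0 := by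
    have h := (hf' (x + (0 : ℝ) • w)).hasFDerivAt.comp_hasDerivAt 0 (hline 0)
    have := h.clm_apply (hasDerivAt_const (0 : ℝ) w)
    simpa using this
  have hconv : ConvexOn ℝ Set.univ (fun t : ℝ => f (x + t • w)) := by
    refine ⟨convex_univ, fun a _ b _ p q hp hq hpq => ?_⟩
    have h := hc.2 (Set.mem_univ (x + a • w)) (Set.mem_univ (x + b • w)) hp hq hpq
    have e : x + (p • a + q • b) • w = p • (x + a • w) + q • (x + b • w) := by
      obtain rfl : q = 1 - p := by linarith
      module
    simpa only [e] using h
  have hmono : Monotone (fun t : ℝ => fderiv ℝ f (x + t • w) w) := by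
    have h := hconv.monotoneOn_deriv (fun t _ => (h1 t).differentiableAt)
    have e : deriv (fun t : ℝ => f (x + t • w)) = fun t : ℝ => fderiv ℝ f (x + t • w) w :=
      funext fun t => (h1 t).deriv
    rw [e] at h
    exact monotoneOn_univ.mp h
  rw [← h2.deriv]
  exact hmono.deriv_nonneg

lemma posSemidef_gaussNewton {n d : ℕ} (g : Fin n → EuclideanSpace ℝ (Fin d)) :
    (gaussNewton g).PosSemidef := by
  refine Matrix.PosSemidef.smul (Matrix.posSemidef_sum _ fun i _ => ?_) (by positivity)
  simpa using Matrix.posSemidef_vecMulVec_self_star (g i : Fin d → ℝ)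

lemma posSemidef_hessian {d : ℕ} {f : EuclideanSpace ℝ (Fin d) → ℝ}
    (hc : ConvexOn ℝ Set.univ f) (hf : Differentiable ℝ f) (hf' : Differentiable ℝ (fderiv ℝ f))
    (θ : EuclideanSpace ℝ (Fin d)) :
    (Matrix.of fun a b => fderiv ℝ (fderiv ℝ f) θ (EuclideanSpace.single a 1)
      (EuclideanSpace.single b 1)).PosSemidef := by
  refine Matrix.PosSemidef.of_dotProduct_mulVec_nonneg ?_ fun x => ?_
  · ext a b
    simpa using second_derivative_symmetric (fun y => (hf y).hasFDerivAt) (hf' θ).hasFDerivAt _ _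
  · have hx : (WithLp.toLp 2 x : EuclideanSpace ℝ (Fin d))
        = ∑ i, x i • EuclideanSpace.single i (1 : ℝ) := by
      ext j
      simp [Pi.single_apply]
    have h := hc.fderiv_fderiv_apply_self_nonneg hf hf' θ (WithLp.toLp 2 x)
    rw [hx] at h
    refine h.trans_eq ?_
    simp only [map_sum, map_smul, _root_.sum_apply, _root_.smul_apply,
      dotProduct, Matrix.mulVec, Matrix.of_apply, smul_eq_mul, Pi.star_apply, star_trivial,
      Finset.mul_sum]
    rw [Finset.sum_comm]
    refine Finset.sum_congr rfl fun i _ => Finset.sum_congr rfl fun j _ => by ring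

lemma IsCurvatureMatrix.posSemidef {n d : ℕ} {H : Matrix (Fin d) (Fin d) ℝ}
    (hH : IsCurvatureMatrix n H) : H.PosSemidef := by
  obtain ⟨g, rfl⟩ | ⟨ℓ, θ, h1, h2, h3, rfl⟩ := hH
  · exact posSemidef_gaussNewton g
  · exact Matrix.PosSemidef.smul
      (Matrix.posSemidef_sum _ fun i _ => posSemidef_hessian (h3 i) (h1 i) (h2 i) θ) (by positivity)

lemma Matrix.PosSemidef.isUnit_smul_one_add {m : ℕ} {A : Matrix (Fin m) (Fin m) ℝ}
    (hA : A.PosSemidef) {c : ℝ} (hc : 0 < c) :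
    IsUnit (c • (1 : Matrix (Fin m) (Fin m) ℝ) + A) :=
  ((Matrix.PosDef.one.smul hc).add_posSemidef hA).isUnit

/-! ### Resolvents and the deterministic error bound -/

/-- The resolvent bound for positive semidefinite matrices. -/
lemma Matrix.PosSemidef.norm_inv_smul_one_add_le {m : ℕ} {A : Matrix (Fin m) (Fin m) ℝ}
    (hA : A.PosSemidef) {c : ℝ} (hc : 0 < c) :
    ‖(c • (1 : Matrix (Fin m) (Fin m) ℝ) + A)⁻¹‖ ≤ 1 / c := by
  set B := c • (1 : Matrix (Fin m) (Fin m) ℝ) + A with hB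
  have hdet : IsUnit B.det := (Matrix.isUnit_iff_isUnit_det _).mp (hA.isUnit_smul_one_add hc)
  rw [Matrix.l2_opNorm_def]
  refine ContinuousLinearMap.opNorm_le_bound _ (by positivity) fun x => ?_
  set y : EuclideanSpace ℝ (Fin m) := Matrix.toEuclideanLin B⁻¹ x with hy
  change ‖y‖ ≤ 1 / c * ‖x‖
  have hyx : B *ᵥ (y : Fin m → ℝ) = x := by
    simp [hy, Matrix.mulVec_mulVec, Matrix.mul_nonsing_inv _ hdet]
  -- Pairing `B y = x` with `y` gives `c‖y‖² ≤ ⟨y, x⟩ ≤ ‖y‖‖x‖`.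
  have h1 : inner ℝ y x = c * ‖y‖ ^ 2 + (y : Fin m → ℝ) ⬝ᵥ (A *ᵥ (y : Fin m → ℝ)) := by
    rw [EuclideanSpace.inner_eq_star_dotProduct, ← hyx, hB, Matrix.add_mulVec,
      EuclideanSpace.real_norm_sq_eq]
    simp only [Matrix.smul_mulVec, Matrix.one_mulVec, dotProduct, star_trivial, Pi.add_apply,
      Pi.smul_apply, smul_eq_mul, Finset.mul_sum, ← Finset.sum_add_distrib]
    exact Finset.sum_congr rfl fun i _ => by ring
  have h2 := hA.dotProduct_mulVec_nonneg (y : Fin m → ℝ)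
  have h3 := real_inner_le_norm y x
  rw [star_trivial] at h2
  have h4 : c * ‖y‖ ≤ ‖x‖ := by
    rcases (norm_nonneg y).eq_or_lt with h0 | h0
    · simp [← h0]
    · refine le_of_mul_le_mul_left ?_ h0
      nlinarith
  rw [one_div, inv_mul_eq_div, le_div_iff₀ hc]
  linarith

lemma norm_compressionError_le {r d : ℕ} {lam : ℝ} (hlam : 0 < lam)
    (P : Matrix (Fin r) (Fin d) ℝ) {H : Matrix (Fin d) (Fin d) ℝ} (hH : H.PosSemidef) :
    ‖compressionError lam P H‖ ≤ (1 + ‖P‖ ^ 2) / lam := by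
  have hP : ‖Pᵀ‖ = ‖P‖ := by
    rw [← Matrix.conjTranspose_eq_transpose_of_trivial, Matrix.l2_opNorm_conjTranspose]
  have hPH : (P * H * Pᵀ).PosSemidef := by
    simpa [Matrix.conjTranspose_eq_transpose_of_trivial] using hH.mul_mul_conjTranspose_same P
  have h1 := hH.norm_inv_smul_one_add_le hlam
  have h2 := hPH.norm_inv_smul_one_add_le hlam
  set R := (lam • (1 : Matrix (Fin r) (Fin r) ℝ) + P * H * Pᵀ)⁻¹
  calc ‖compressionError lam P H‖ ≤ 1 / lam + ‖P‖ * (1 / lam) * ‖P‖ := by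
        refine (norm_sub_le _ _).trans (add_le_add h1 ?_)
        refine (Matrix.l2_opNorm_mul _ _).trans ?_
        gcongr
        refine (Matrix.l2_opNorm_mul _ _).trans ?_
        rw [hP]
        gcongr
    _ = (1 + ‖P‖ ^ 2) / lam := by ring

lemma sigmaMax_nonneg {m n : ℕ} (A : Matrix (Fin m) (Fin n) ℝ) : 0 ≤ sigmaMax A :=
  (Matrix.toEuclideanLin A).singularValues_nonneg 0

/-- A bound `‖P‖² ≤ C d` on the spectral norm of the projection gives the compression error
bound. -/
lemma CompressionErrorBound.of_norm_sq_le {r d : ℕ} {lam C : ℝ} (hlam : 0 < lam) (hC : 0 ≤ C)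
    {P : Matrix (Fin r) (Fin d) ℝ} (hP : ‖P‖ ^ 2 ≤ C * d) :
    CompressionErrorBound lam ((1 + C) / lam) P := by
  intro n hn hnd H hH _
  have hpos := hH.posSemidef
  have hPH : (P * H * Pᵀ).PosSemidef := by
    simpa [Matrix.conjTranspose_eq_transpose_of_trivial] using hpos.mul_mul_conjTranspose_same P
  refine ⟨hpos.isUnit_smul_one_add hlam, hPH.isUnit_smul_one_add hlam,
    (norm_compressionError_le hlam P hpos).trans ?_⟩
  -- Since `0 < n < d`, the summand 1 is absorbed into `d`.
  have hd : (1 : ℝ) ≤ d := by exact_mod_cast (by omega : 1 ≤ d)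
  have hs := sigmaMax_nonneg H
  calc (1 + ‖P‖ ^ 2) / lam ≤ (1 + C) * d / lam := by gcongr; linarith
    _ = (1 + C) / lam * d := by ring
    _ ≤ (1 + C) / lam * (d + d ^ 2 * sigmaMax H) := by
      gcongr
      linarith [mul_nonneg (sq_nonneg (d : ℝ)) hs]

/-! ### Spectral norm of a Gaussian matrix -/

/-- Near a pair of almost maximizing vectors, the bilinear form of an operator `T` is at least a
fixed fraction of `‖T‖`. -/
lemma ContinuousLinearMap.exists_forall_ball_le_inner {E F : Type*} [NormedAddCommGroup E]
    [InnerProductSpace ℝ E] [NormedAddCommGroup F] [InnerProductSpace ℝ F] (T : E →L[ℝ] F)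
    (hT : 0 < ‖T‖) : ∃ (u₀ : E) (v₀ : F), ‖u₀‖ ≤ 1 ∧ ‖v₀‖ ≤ 1 ∧
      ∀ u ∈ Metric.ball u₀ (1 / 8), ∀ v ∈ Metric.ball v₀ (1 / 8), ‖T‖ / 8 ≤ inner ℝ v (T u) := by
  -- Moving `u` and `v` by `1/8` costs at most `(1/8 + 9/64)‖T‖`, so starting from `3/4 ‖T‖` leaves
  -- more than `‖T‖/8`.
  obtain ⟨x, hx, hTx⟩ := T.exists_lt_apply_of_lt_opNorm (r := 3 / 4 * ‖T‖) (by linarith)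
  have hpos : 0 < ‖T x‖ := by linarith
  have hv : ‖(‖T x‖⁻¹ • T x)‖ = 1 := by
    rw [norm_smul, norm_inv, norm_norm, inv_mul_cancel₀ hpos.ne']
  refine ⟨x, ‖T x‖⁻¹ • T x, hx.le, hv.le, fun u hu v hv' => ?_⟩
  rw [mem_ball_iff_norm] at hu hv'
  set w := ‖T x‖⁻¹ • T x with hw
  have h1 : inner ℝ w (T x) = ‖T x‖ := by
    rw [hw, real_inner_smul_left, real_inner_self_eq_norm_sq]
    field_simp
  have h2 : inner ℝ v (T u) = inner ℝ w (T x) + inner ℝ w (T (u - x)) + inner ℝ (v - w) (T u) := by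
    rw [map_sub, inner_sub_right, inner_sub_left]; ring
  have h3 : -(‖T‖ * (1 / 8)) ≤ inner ℝ w (T (u - x)) := by
    have := abs_le.mp (abs_real_inner_le_norm w (T (u - x)))
    have := T.le_opNorm_of_le hu.le
    rw [hv] at *
    linarith
  have hu' : ‖u‖ ≤ 9 / 8 := by
    have := norm_add_le (u - x) x
    rw [sub_add_cancel] at this
    linarith
  have h4 : -(1 / 8 * (‖T‖ * (9 / 8))) ≤ inner ℝ (v - w) (T u) := by
    have h := abs_le.mp (abs_real_inner_le_norm (v - w) (T u))
    have := mul_le_mul hv'.le (T.le_opNorm_of_le hu') (norm_nonneg _) (by norm_num)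
    linarith
  rw [h2, h1]
  linarith

/-- The exponential moments of the bilinear form of a Gaussian projection. -/
lemma IsGaussianProjection.lintegral_exp_bilin {Ω : Type*} [MeasurableSpace Ω] {μ : Measure Ω}
    [IsProbabilityMeasure μ] {r d : ℕ} {P : Ω → Matrix (Fin r) (Fin d) ℝ}
    (hP : IsGaussianProjection μ P) (s : ℝ) (u : EuclideanSpace ℝ (Fin d))
    (v : EuclideanSpace ℝ (Fin r)) :
    ∫⁻ ω, ENNReal.ofReal (Real.exp (s * ∑ ij : Fin r × Fin d, v ij.1 * u ij.2 * P ω ij.1 ij.2)) ∂μ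
      = ENNReal.ofReal (Real.exp (s ^ 2 * (‖u‖ ^ 2 * ‖v‖ ^ 2) / 2)) := by
  set X : Fin r × Fin d → Ω → ℝ := fun ij ω => v ij.1 * u ij.2 * P ω ij.1 ij.2 with hX
  have hmeas : ∀ ij : Fin r × Fin d, AEMeasurable (fun ω => P ω ij.1 ij.2) μ :=
    fun ij => (hP.1 ij.1 ij.2).aemeasurable
  have hXm : ∀ ij, AEMeasurable (X ij) μ := fun ij => (hmeas ij).const_mul _
  have hind : iIndepFun X μ :=
    hP.2.comp (fun ij x => v ij.1 * u ij.2 * x) fun ij => measurable_const_mul _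
  have hm : mgf (∑ ij, X ij) μ s = Real.exp (s ^ 2 * (‖u‖ ^ 2 * ‖v‖ ^ 2) / 2) := by
    rw [hind.mgf_sum₀ hXm]
    have : ∀ ij, mgf (X ij) μ s = Real.exp (s ^ 2 / 2 * (v ij.1 ^ 2 * u ij.2 ^ 2)) := fun ij => by
      rw [hX, mgf_const_mul, mgf_gaussianReal (hP.1 ij.1 ij.2).map_eq]
      congr 1
      simp
      ring
    simp_rw [this]
    rw [← Real.exp_sum, ← Finset.mul_sum, Fintype.sum_prod_type, EuclideanSpace.real_norm_sq_eq,
      EuclideanSpace.real_norm_sq_eq]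
    simp_rw [← Finset.mul_sum, ← Finset.sum_mul]
    congr 1
    ring
  have hint : Integrable (fun ω => Real.exp (s * (∑ ij, X ij) ω)) μ := by
    -- A non-integrable exponential would have `mgf` equal to the default 0, so positivity yields
    -- integrability.
    rw [← mgf_pos_iff, hm]
    exact Real.exp_pos _
  rw [← hm, mgf, ofReal_integral_eq_lintegral_ofReal hint (ae_of_all _ fun _ => by positivity)]
  simp [hX]

lemma inner_toEuclideanLin_eq_sum {r d : ℕ} (P : Matrix (Fin r) (Fin d) ℝ)
    (u : EuclideanSpace ℝ (Fin d)) (v : EuclideanSpace ℝ (Fin r)) :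
    inner ℝ v (Matrix.toEuclideanLin P u)
      = ∑ ij : Fin r × Fin d, v ij.1 * u ij.2 * P ij.1 ij.2 := by
  rw [Fintype.sum_prod_type, EuclideanSpace.inner_eq_star_dotProduct]
  simp only [dotProduct, Matrix.ofLp_toLpLin, Matrix.toLin'_apply, Matrix.mulVec, Finset.sum_mul,
    Pi.star_apply, star_trivial]
  exact Finset.sum_congr rfl fun i _ => Finset.sum_congr rfl fun j _ => by ring

/-- The radii have ratio `2 / (1/8) = 16`, and Lebesgue measure is translation invariant. -/
lemma volume_ball_two_prod_ball_two {E F : Type*} [NormedAddCommGroup E] [InnerProductSpace ℝ E]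
    [FiniteDimensional ℝ E] [MeasurableSpace E] [BorelSpace E] [NormedAddCommGroup F]
    [InnerProductSpace ℝ F] [FiniteDimensional ℝ F] [MeasurableSpace F] [BorelSpace F]
    (x : E) (y : F) :
    volume (Metric.ball (0 : E) 2 ×ˢ Metric.ball (0 : F) 2)
      = ENNReal.ofReal (16 ^ (Module.finrank ℝ E + Module.finrank ℝ F))
        * volume (Metric.ball x (1 / 8) ×ˢ Metric.ball y (1 / 8)) := by
  have hE := Measure.addHaar_ball_mul_of_pos (volume : Measure E) 0 (by norm_num : (0 : ℝ) < 16)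
    (1 / 8)
  have hF := Measure.addHaar_ball_mul_of_pos (volume : Measure F) 0 (by norm_num : (0 : ℝ) < 16)
    (1 / 8)
  norm_num only at hE hF
  rw [Measure.volume_eq_prod, Measure.prod_prod, Measure.prod_prod, hE, hF,
    Measure.addHaar_ball_center volume x, Measure.addHaar_ball_center volume y, pow_add,
    ENNReal.ofReal_mul (by positivity)]
  ring

lemma pow_sixteen_mul_exp_le {r d : ℕ} (hrd : r ≤ d) :
    Real.exp (8 * d) * 16 ^ (d + r) ≤ Real.exp (15 * d) * Real.exp (-(d : ℝ)) := by
  have h256 : (256 : ℝ) ≤ Real.exp 6 := by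
    have h := pow_le_pow_left₀ (by norm_num) Real.exp_one_gt_d9.le 6
    rw [← Real.exp_nat_mul] at h
    norm_num at h ⊢
    linarith
  have h16 : (16 : ℝ) ^ (d + r) ≤ Real.exp (6 * d) :=
    calc (16 : ℝ) ^ (d + r) ≤ 16 ^ (2 * d) := pow_le_pow_right₀ (by norm_num) (by omega)
      _ = 256 ^ d := by rw [pow_mul]; norm_num
      _ ≤ Real.exp 6 ^ d := by gcongr
      _ = Real.exp (6 * d) := by rw [← Real.exp_nat_mul, mul_comm]
  calc Real.exp (8 * d) * 16 ^ (d + r) ≤ Real.exp (8 * d) * Real.exp (6 * d) := by gcongr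
    _ = Real.exp (15 * d) * Real.exp (-(d : ℝ)) := by
      rw [← Real.exp_add, ← Real.exp_add]
      congr 1
      ring

/-- The spectral norm of an `r × d` Gaussian projection with `r ≤ d` is of order `√d`, up to an
event of probability at most `e^{-d}`. -/
lemma IsGaussianProjection.measure_norm_ge_le {Ω : Type*} [MeasurableSpace Ω] {μ : Measure Ω}
    [IsProbabilityMeasure μ] {r d : ℕ} (hrd : r ≤ d) (hd : 0 < d)
    {P : Ω → Matrix (Fin r) (Fin d) ℝ} (hP : IsGaussianProjection μ P) :
    μ {ω | 120 * √(d : ℝ) ≤ ‖P ω‖} ≤ ENNReal.ofReal (Real.exp (-(d : ℝ))) := by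
  set S : Set (EuclideanSpace ℝ (Fin d) × EuclideanSpace ℝ (Fin r)) :=
    Metric.ball 0 2 ×ˢ Metric.ball 0 2 with hS
  set G : Ω → EuclideanSpace ℝ (Fin d) × EuclideanSpace ℝ (Fin r) → ℝ≥0∞ :=
    fun ω p => ENNReal.ofReal
    (Real.exp (√(d : ℝ) * ∑ ij : Fin r × Fin d, p.2 ij.1 * p.1 ij.2 * P ω ij.1 ij.2)) with hG
  set V : ℝ≥0∞ :=
    volume (Metric.ball (0 : EuclideanSpace ℝ (Fin d)) (1 / 8) ×ˢ
      Metric.ball (0 : EuclideanSpace ℝ (Fin r)) (1 / 8)) with hV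
  have hball : ∀ (x : EuclideanSpace ℝ (Fin d)) (y : EuclideanSpace ℝ (Fin r)),
      volume (Metric.ball x (1 / 8) ×ˢ Metric.ball y (1 / 8)) = V := fun x y => by
    rw [hV, Measure.volume_eq_prod, Measure.prod_prod, Measure.prod_prod,
      Measure.addHaar_ball_center volume x, Measure.addHaar_ball_center volume y]
  have hV0 : V ≠ 0 := by
    rw [hV, Measure.volume_eq_prod, Measure.prod_prod]
    exact mul_ne_zero (Metric.measure_ball_pos _ _ (by norm_num)).ne'
      (Metric.measure_ball_pos _ _ (by norm_num)).ne'
  have hVtop : V ≠ ∞ := by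
    rw [hV, Measure.volume_eq_prod, Measure.prod_prod]
    exact ENNReal.mul_ne_top measure_ball_lt_top.ne measure_ball_lt_top.ne
  have hSV : volume S = ENNReal.ofReal (16 ^ (d + r)) * V := by
    rw [hS, hV, volume_ball_two_prod_ball_two (0 : EuclideanSpace ℝ (Fin d))
      (0 : EuclideanSpace ℝ (Fin r))]
    simp
  have hSm : MeasurableSet S := measurableSet_ball.prod measurableSet_ball
  have hGm : AEMeasurable (Function.uncurry G) (μ.prod (volume.restrict S)) := by
    refine (Real.measurable_exp.comp_aemeasurable
      (AEMeasurable.const_mul (Finset.aemeasurable_fun_sum _ fun ij _ => ?_) _)).ennreal_ofReal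
    refine AEMeasurable.mul (Measurable.aemeasurable ?_) (hP.1 ij.1 ij.2).aemeasurable.comp_fst
    fun_prop
  have hupper : ∫⁻ ω, (∫⁻ p in S, G ω p) ∂μ
      ≤ ENNReal.ofReal (Real.exp (8 * d)) * (ENNReal.ofReal (16 ^ (d + r)) * V) := by
    -- By Tonelli, the Gaussian moment is computed at fixed `(u, v)`; on `S` its exponent is at most
    -- `d · 2² · 2² / 2 = 8d`.
    rw [lintegral_lintegral_swap hGm, ← hSV, ← setLIntegral_const]
    refine setLIntegral_mono' hSm fun p hp => ?_
    rw [hG, hP.lintegral_exp_bilin]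
    have h1 : ‖p.1‖ ≤ 2 := (mem_ball_zero_iff.mp hp.1).le
    have h2 : ‖p.2‖ ≤ 2 := (mem_ball_zero_iff.mp hp.2).le
    rw [Real.sq_sqrt (Nat.cast_nonneg d)]
    gcongr
    calc (d : ℝ) * (‖p.1‖ ^ 2 * ‖p.2‖ ^ 2) / 2 ≤ d * (2 ^ 2 * 2 ^ 2) / 2 := by gcongr
      _ = 8 * (d : ℝ) := by ring
  have hlower : {ω | 120 * √(d : ℝ) ≤ ‖P ω‖}
      ⊆ {ω | ENNReal.ofReal (Real.exp (15 * d)) * V ≤ ∫⁻ p in S, G ω p} := by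
    intro ω hω
    rw [Set.mem_ofPred_eq, Matrix.l2_opNorm_def] at hω
    have hd' : 0 < √(d : ℝ) := Real.sqrt_pos.mpr (Nat.cast_pos.mpr hd)
    obtain ⟨u, v, hu, hv, h⟩ := ContinuousLinearMap.exists_forall_ball_le_inner _
      (lt_of_lt_of_le (by positivity) hω)
    have hsub : Metric.ball u (1 / 8) ×ˢ Metric.ball v (1 / 8) ⊆ S :=
      Set.prod_mono (Metric.ball_subset_ball' (by rw [dist_zero_right]; linarith))
        (Metric.ball_subset_ball' (by rw [dist_zero_right]; linarith))
    rw [Set.mem_ofPred_eq, ← hball u v, ← setLIntegral_const]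
    refine (setLIntegral_mono' (measurableSet_ball.prod measurableSet_ball) fun p hp => ?_).trans
      (lintegral_mono_set hsub)
    refine ENNReal.ofReal_le_ofReal (Real.exp_le_exp.mpr ?_)
    have h1 := h p.1 hp.1 p.2 hp.2
    rw [LinearEquiv.trans_apply, LinearMap.coe_toContinuousLinearMap',
      inner_toEuclideanLin_eq_sum] at h1
    -- The threshold 120 is chosen so that `120/8 = 15` exceeds `8 + 6`.
    calc (15 : ℝ) * d = √d * (120 * √d / 8) := by
          linear_combination (-15 : ℝ) * Real.mul_self_sqrt (Nat.cast_nonneg (α := ℝ) d)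
      _ ≤ _ := by
          gcongr
          exact (div_le_div_of_nonneg_right hω (by norm_num)).trans h1
  have hmarkov := (mul_meas_ge_le_lintegral₀ hGm.lintegral_prod_right'
    (ENNReal.ofReal (Real.exp (15 * d)) * V)).trans hupper
  have hc0 : ENNReal.ofReal (Real.exp (15 * d)) ≠ 0 := by simp [Real.exp_pos]
  refine (measure_mono hlower).trans ?_
  refine (ENNReal.mul_le_mul_iff_right (mul_ne_zero hc0 hV0)
    (ENNReal.mul_ne_top ENNReal.ofReal_ne_top hVtop)).mp (hmarkov.trans ?_)
  rw [← mul_assoc, mul_right_comm _ V, ← ENNReal.ofReal_mul (Real.exp_nonneg _),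
    ← ENNReal.ofReal_mul (Real.exp_nonneg _)]
  exact mul_le_mul_left (ENNReal.ofReal_le_ofReal (pow_sixteen_mul_exp_le hrd)) V

lemma IsGaussianProjection.measure_not_compressionErrorBound_le {lam : ℝ} (hlam : 0 < lam)
    {Ω : Type*} [MeasurableSpace Ω] {μ : Measure Ω} [IsProbabilityMeasure μ] {r d : ℕ}
    (hrd : r ≤ d) {P : Ω → Matrix (Fin r) (Fin d) ℝ} (hP : IsGaussianProjection μ P) :
    μ {ω | ¬ CompressionErrorBound lam ((1 + 120 ^ 2) / lam) (P ω)}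
      ≤ ENNReal.ofReal (Real.exp (-(d : ℝ))) := by
  rcases Nat.eq_zero_or_pos d with rfl | hd
  -- For `d = 0` the claimed bound is `e^0 = 1`.
  · simpa using prob_le_one
  · refine (measure_mono fun ω hω => ?_).trans (hP.measure_norm_ge_le hrd hd)
    by_contra hlt
    refine hω (CompressionErrorBound.of_norm_sq_le hlam (by norm_num) ?_)
    have h := pow_le_pow_left₀ (norm_nonneg (P ω)) (not_le.mp hlt).le 2
    rwa [mul_pow, Real.sq_sqrt (Nat.cast_nonneg d)] at h

theorem theorem1 (lam : ℝ) (hlam : 0 < lam) :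
    ∃ K : ℝ, 0 < K ∧
      -- Non-asymptotic form: in every dimension the bound fails with probability at most `e^{-d}`.
      (∀ (r d : ℕ), r ≤ d →
        ∀ (Ω : Type*) [MeasurableSpace Ω] (μ : Measure Ω) [IsProbabilityMeasure μ]
          (P : Ω → Matrix (Fin r) (Fin d) ℝ), IsGaussianProjection μ P →
          μ {ω | ¬ CompressionErrorBound lam K (P ω)} ≤ ENNReal.ofReal (Real.exp (-(d : ℝ)))) ∧
      -- Asymptotic form: almost surely the bound holds in all sufficiently large dimensions.
      (∀ (r : ℕ → ℕ), (∀ d, r d ≤ d) →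
        ∀ (Ω : Type*) [MeasurableSpace Ω] (μ : Measure Ω) [IsProbabilityMeasure μ]
          (P : (d : ℕ) → Ω → Matrix (Fin (r d)) (Fin d) ℝ),
          (∀ d, IsGaussianProjection μ (P d)) →
          ∀ᵐ ω ∂μ, ∀ᶠ d : ℕ in atTop, CompressionErrorBound lam K (P d ω)) := by
  refine ⟨(1 + 120 ^ 2) / lam, by positivity, fun r d hrd Ω _ μ _ P hP =>
    hP.measure_not_compressionErrorBound_le hlam hrd, fun r hr Ω _ μ _ P hP => ?_⟩
  -- Borel–Cantelli: summability of `e^{-d}` suffices, with no independence between dimensions.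
  have hsum : ∑' d : ℕ, μ {ω | ¬ CompressionErrorBound lam ((1 + 120 ^ 2) / lam) (P d ω)} ≠ ∞ :=
    ne_top_of_le_ne_top Real.summable_exp_neg_nat.tsum_ofReal_ne_top
      (ENNReal.tsum_le_tsum fun d => (hP d).measure_not_compressionErrorBound_le hlam (hr d))
  filter_upwards [ae_eventually_notMem hsum] with ω hω
  filter_upwards [hω] with d hd
  exact not_not.mp hd
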